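/- Let $X$ be a linear metric space, that is, a real topological vector space whose topology is metrizable, and let $A$ be an additive subgroup of $X$ that is analytic, i.e. (with the subspace topology) a continuous image of a Polish space. Suppose that $A$ is not a Polish space and that $A$ contains a convex set $C$ such that $C$ has a dense Polish subspace and the affine hull of $C$ is dense in $X$. Then $A$ is a $\sigma Z_\omega$-space: $A=\bigcup_{n\in\mathbb N}F_n$ where each $F_n$ is a $Z_\omega$-set in $A$. Here a subset $F$ of a topological space $Y$ is called a $Z_\omega$-set in $Y$ if $F$ is closed in $Y$ and the set of continuous maps $[0,1]^{\omega}\to Y$ with image in $Y\setminus F$ is dense in the space $C([0,1]^\omega,Y)$ of all continuous maps from the Hilbert cube to $Y$, endowed with the compact-open topology. -/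

import Mathlib

/-- A topological space is densely-Polish if it contains a dense Polish subspace. -/
def DenselyPolishSpace (Y : Type*) [TopologicalSpace Y] : Prop :=
  ∃ P : Set Y, Dense P ∧ PolishSpace P

/-- A subset `B` of `Y` is `ω`-dense if the maps from the Hilbert cube `[0,1]^ω` into `B` are
dense in the space of all continuous maps `[0,1]^ω → Y` with the compact-open topology. -/
def IsOmegaDense {Y : Type*} [TopologicalSpace Y] (B : Set Y) : Prop :=
  Dense {f : C(ℕ → unitInterval, Y) | ∀ z, f z ∈ B}

/-- A `Z_ω`-set in `Y` is a closed set whose complement is `ω`-dense in `Y`. -/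
def IsZOmegaSet {Y : Type*} [TopologicalSpace Y] (F : Set Y) : Prop :=
  IsClosed F ∧ IsOmegaDense Fᶜ

/-- A `σZ_ω`-space is a countable union of its `Z_ω`-sets. -/
def IsSigmaZOmegaSpace (Y : Type*) [TopologicalSpace Y] : Prop :=
  ∃ F : ℕ → Set Y, (∀ n, IsZOmegaSet (F n)) ∧ ⋃ n, F n = Set.univ

open Set Topology Filter Pointwise
open scoped unitInterval

/-! ### Analytic topological groups -/

section Baire

variable {H : Type*} [TopologicalSpace H]

/-! A nonmeagre analytic metrizable group fills its completion: if `D` is a dense nonmeagre analytic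
subgroup, suitable translates of `D` meet `D`, so every point is a combination of elements of `D`
(`polishSpace_of_not_isMeagre_univ`). As `A` is not Polish, it is therefore meagre in itself, hence
covered by countably many nowhere dense sets.

By convexity of `C` the linear span of `C - c` lies in `A`, and it is dense in `X`. Maps of the
Hilbert cube into `A` are thus approximated by maps `g` into finite-dimensional pieces of this span
(`dense_finiteSpanMaps`), and the image of `g` is covered by finitely many translates of `N ∩ C`,
for any neighborhood `N` of `c`. If `S - (N ∩ C)` lies in a closed set with empty interior, then so
does `S - g(Q)`, where `Q` is the cube, and a small translate `g + a` misses `closure S`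
(`isZOmegaSet_closure`).

To find such `S`, parametrize `A` by the Baire space and discard the open sets whose images are
covered by countably many `Z_ω`-sets. If the remainder `G` were nonempty, the Baire theorem on `G ×
P`, with `P` dense Polish in `C`, applied to differences, would yield a relatively open piece of `G`
with `Z_ω` image closure, a contradiction. -/

/-- `S` is nonmeagre in every nonempty open subset of `W`. -/
def EverywhereNonmeagre (S W : Set H) : Prop :=
  ∀ V ⊆ W, IsOpen V → V.Nonempty → ¬ IsMeagre (S ∩ V)

theorem EverywhereNonmeagre.mono {S T W V : Set H} (h : EverywhereNonmeagre S W) (hST : S ⊆ T)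
    (hVW : V ⊆ W) : EverywhereNonmeagre T V :=
  fun U hU hUo hUn hm => h U (hU.trans hVW) hUo hUn (hm.mono (inter_subset_inter_left _ hST))

theorem EverywhereNonmeagre.subset_closure {S W : Set H} (h : EverywhereNonmeagre S W)
    (hW : IsOpen W) : W ⊆ closure S := by
  intro x hx
  rw [mem_closure_iff]
  intro V hV hxV
  obtain ⟨y, hyS, hyV, -⟩ := nonempty_of_not_isMeagre
    (h (V ∩ W) inter_subset_right (hV.inter hW) ⟨x, hxV, hx⟩)
  exact ⟨y, hyV, hyS⟩

/-- The Banach category theorem in a second-countable space. -/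
theorem exists_everywhereNonmeagre [SecondCountableTopology H] {S : Set H} (hS : ¬ IsMeagre S) :
    ∃ W, IsOpen W ∧ W.Nonempty ∧ EverywhereNonmeagre S W := by
  by_contra! hcon
  obtain ⟨T, hTc, hTS, hTU⟩ := TopologicalSpace.isOpen_sUnion_countable
    {V : Set H | IsOpen V ∧ IsMeagre (S ∩ V)} (fun V hV => hV.1)
  set U := ⋃₀ {V : Set H | IsOpen V ∧ IsMeagre (S ∩ V)} with hU
  have hUo : IsOpen U := isOpen_sUnion fun V hV => hV.1
  have hdense : Dense U := by
    rw [dense_iff_inter_open]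
    intro W hW hWn
    have := hcon W hW hWn
    simp only [EverywhereNonmeagre, not_forall, not_not] at this
    obtain ⟨V, hVW, hVo, ⟨x, hx⟩, hm⟩ := this
    exact ⟨x, hVW hx, V, ⟨hVo, hm⟩, hx⟩
  have h1 : IsMeagre Uᶜ := by
    refine IsNowhereDense.isMeagre ?_
    rw [IsNowhereDense, hUo.isClosed_compl.closure_eq, interior_compl, hdense.closure_eq,
      compl_univ]
  have h2 : IsMeagre (⋃ V ∈ T, S ∩ V) := isMeagre_biUnion hTc fun V hV => (hTS hV).2
  refine hS ((h1.union h2).mono fun x hx => ?_)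
  by_cases hxU : x ∈ U
  · rw [← hTU] at hxU
    obtain ⟨V, hV, hxV⟩ := hxU
    exact Or.inr (mem_biUnion hV ⟨hx, hxV⟩)
  · exact Or.inl hxU

theorem EverywhereNonmeagre.exists_of_iUnion [SecondCountableTopology H] {ι : Type*} [Countable ι]
    {S : ι → Set H} {W : Set H} (hW : IsOpen W) (hWn : W.Nonempty)
    (h : EverywhereNonmeagre (⋃ i, S i) W) :
    ∃ i, ∃ V ⊆ W, IsOpen V ∧ V.Nonempty ∧ EverywhereNonmeagre (S i) V := by
  have h0 := h W Subset.rfl hW hWn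
  rw [iUnion_inter] at h0
  obtain ⟨i, hi⟩ : ∃ i, ¬ IsMeagre (S i ∩ W) := by
    by_contra! hcon
    exact h0 (isMeagre_iUnion hcon)
  obtain ⟨V, hVo, hVn, hV⟩ := exists_everywhereNonmeagre hi
  obtain ⟨y, ⟨-, hyW⟩, hyV⟩ := nonempty_of_not_isMeagre (hV V Subset.rfl hVo hVn)
  exact ⟨i, V ∩ W, inter_subset_right, hVo.inter hW, ⟨y, hyV, hyW⟩,
    hV.mono inter_subset_left inter_subset_left⟩

theorem EverywhereNonmeagre.exists_cylinder [SecondCountableTopology H] {g : (ℕ → ℕ) → H}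
    {x : ℕ → ℕ} {n : ℕ} {W : Set H} (hW : IsOpen W) (hWn : W.Nonempty)
    (h : EverywhereNonmeagre (g '' PiNat.cylinder x n) W) :
    ∃ y ∈ PiNat.cylinder x n, ∃ V ⊆ W, IsOpen V ∧ V.Nonempty ∧
      EverywhereNonmeagre (g '' PiNat.cylinder y (n + 1)) V := by
  rw [← PiNat.iUnion_cylinder_update, image_iUnion] at h
  obtain ⟨k, V, hVW, hV⟩ := h.exists_of_iUnion hW hWn
  exact ⟨_, PiNat.update_mem_cylinder x n k, V, hVW, hV⟩

/-- Two continuous images of the Baire space that are everywhere nonmeagre in the same open set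
meet. -/
theorem exists_eq_of_everywhereNonmeagre [SecondCountableTopology H] [T25Space H]
    {f g : (ℕ → ℕ) → H} (hf : Continuous f) (hg : Continuous g) {W : Set H} (hW : IsOpen W)
    (hWn : W.Nonempty) (hfW : EverywhereNonmeagre (range f) W)
    (hgW : EverywhereNonmeagre (range g) W) : ∃ z z', f z = g z' := by
  let P (n : ℕ) (p : (ℕ → ℕ) × (ℕ → ℕ) × Set H) : Prop :=
    IsOpen p.2.2 ∧ p.2.2.Nonempty ∧ EverywhereNonmeagre (f '' PiNat.cylinder p.1 n) p.2.2 ∧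
      EverywhereNonmeagre (g '' PiNat.cylinder p.2.1 n) p.2.2
  have step (n : ℕ) (p : {p // P n p}) : ∃ q : {q // P (n + 1) q},
      q.1.1 ∈ PiNat.cylinder p.1.1 n ∧ q.1.2.1 ∈ PiNat.cylinder p.1.2.1 n := by
    obtain ⟨⟨x, x', W⟩, hW, hWn, h, h'⟩ := p
    obtain ⟨y, hy, V, hVW, hV, hVn, hyV⟩ := h.exists_cylinder hW hWn
    obtain ⟨y', hy', V', hVW', hV', hVn', hyV'⟩ :=
      (h'.mono Subset.rfl hVW).exists_cylinder hV hVn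
    exact ⟨⟨⟨y, y', V'⟩, hV', hVn', hyV.mono Subset.rfl hVW', hyV'⟩, hy, hy'⟩
  choose s hs hs' using step
  let p : (n : ℕ) → {p // P n p} := fun n => Nat.rec
    ⟨⟨0, 0, W⟩, hW, hWn, by simpa using hfW, by simpa using hgW⟩ s n
  have hp (n : ℕ) : p (n + 1) = s n (p n) := rfl
  -- Stage `n + 1` preserves the first `n` coordinates of its predecessor, so coordinate `i` is
  -- final from stage `i + 1` on and the diagonal gives the limit point.
  have key (u : (n : ℕ) → {p // P n p} → (ℕ → ℕ))
      (hu : ∀ n q, u (n + 1) (s n q) ∈ PiNat.cylinder (u n q) n) (n : ℕ) :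
      PiNat.cylinder (u n (p n)) n = PiNat.cylinder (fun i => u (i + 1) (p (i + 1)) i) n := by
    rw [← PiNat.mem_cylinder_iff_eq, PiNat.mem_cylinder_iff]
    induction n with
    | zero => simp
    | succ n ih =>
      intro i hi
      rcases Nat.lt_succ_iff_lt_or_eq.1 hi with hi | rfl
      · rw [← ih i hi]
        exact PiNat.mem_cylinder_iff.1 (hu n (p n)) i hi
      · rfl
  have hz := key (fun _ q => q.1.1) hs
  have hz' := key (fun _ q => q.1.2.1) hs'
  set z : ℕ → ℕ := fun i => (p (i + 1)).1.1 i
  set z' : ℕ → ℕ := fun i => (p (i + 1)).1.2.1 i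
  refine ⟨z, z', ?_⟩
  by_contra hne
  obtain ⟨U, hzU, hU, U', hzU', hU', hUU'⟩ := exists_open_nhds_disjoint_closure hne
  have small (z : ℕ → ℕ) (O : Set (ℕ → ℕ)) (hO : IsOpen O) (hz : z ∈ O) :
      ∃ n, PiNat.cylinder z n ⊆ O := by
    obtain ⟨n, hn⟩ := PiNat.exists_disjoint_cylinder hO.isClosed_compl (x := z) (by simpa)
    exact ⟨n, (disjoint_compl_left_iff_subset.1 hn)⟩
  obtain ⟨n, hn⟩ := small z _ (hU.preimage hf) hzU
  obtain ⟨n', hn'⟩ := small z' _ (hU'.preimage hg) hzU'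
  obtain ⟨hVo, ⟨y, hy⟩, h1, h2⟩ := (p (max n n')).2
  rw [hz] at h1
  rw [hz'] at h2
  refine disjoint_left.1 hUU' (closure_mono ?_ (h1.subset_closure hVo hy))
    (closure_mono ?_ (h2.subset_closure hVo hy))
  · exact image_subset_iff.2 ((PiNat.cylinder_anti z (le_max_left _ _)).trans hn)
  · exact image_subset_iff.2 ((PiNat.cylinder_anti z' (le_max_right _ _)).trans hn')

end Baire

theorem IsMeagre.image_homeomorph {X Y : Type*} [TopologicalSpace X] [TopologicalSpace Y]
    (e : X ≃ₜ Y) {S : Set X} (hS : IsMeagre S) : IsMeagre (e '' S) :=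
  e.isInducing.isMeagre_image hS

theorem EverywhereNonmeagre.image {X Y : Type*} [TopologicalSpace X] [TopologicalSpace Y]
    (e : X ≃ₜ Y) {S W : Set X} (h : EverywhereNonmeagre S W) :
    EverywhereNonmeagre (e '' S) (e '' W) := by
  intro V hV hVo hVn hm
  have h1 := hm.image_homeomorph e.symm
  have hsymm (T : Set X) : e.symm '' (e '' T) = T := by simp [← image_comp]
  rw [image_inter e.symm.injective, hsymm] at h1
  refine h (e.symm '' V) ?_ (e.symm.isOpenMap V hVo) (hVn.image _) h1
  rw [← hsymm W]
  exact image_mono hV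

/-- A dense nonmeagre analytic subgroup is the whole group. -/
theorem AddSubgroup.eq_univ_of_not_isMeagre {H : Type*} [AddCommGroup H] [TopologicalSpace H]
    [IsTopologicalAddGroup H] [T2Space H] [SecondCountableTopology H] (D : AddSubgroup H)
    (hD : Dense (D : Set H)) {f : (ℕ → ℕ) → H} (hf : Continuous f) (hfD : range f = D)
    (hm : ¬ IsMeagre (D : Set H)) : (D : Set H) = univ := by
  obtain ⟨W, hW, hWn, hWD⟩ := exists_everywhereNonmeagre hm
  refine eq_univ_of_forall fun y => ?_
  -- The coset `y + D` is everywhere nonmeagre in `y + W`. A shift by some `a ∈ D` makes it overlap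
  -- `W`, where it must meet `D`; then `y ∈ D`.
  have hyW : EverywhereNonmeagre (range fun x => y + f x) ((fun x => y + x) '' W) := by
    have := hWD.image (Homeomorph.addLeft y)
    rw [← hfD, ← range_comp] at this
    exact this
  obtain ⟨w, hw⟩ := hWn
  have hopen : IsOpen {a : H | a + (y + w) ∈ W} := hW.preimage (continuous_add_const _)
  obtain ⟨a, ha, haD⟩ := hD.inter_open_nonempty _ hopen ⟨w - (y + w), by simpa using hw⟩
  have hyW' := hyW.image (Homeomorph.addLeft a)
  obtain ⟨z, z', hzz⟩ := exists_eq_of_everywhereNonmeagre (f := f) (g := fun x => a + (y + f x))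
    hf (by fun_prop)
    (W := W ∩ (Homeomorph.addLeft a '' ((fun x => y + x) '' W)))
    (hW.inter ((Homeomorph.addLeft a).isOpenMap _ ((Homeomorph.addLeft y).isOpenMap _ hW)))
    ⟨a + (y + w), ha, _, ⟨w, hw, rfl⟩, rfl⟩
    (hWD.mono hfD.ge inter_subset_left)
    (hyW'.mono (by rw [← range_comp]; rfl) inter_subset_right)
  have h1 : f z ∈ D := by rw [← SetLike.mem_coe, ← hfD]; exact mem_range_self _
  have h2 : f z' ∈ D := by rw [← SetLike.mem_coe, ← hfD]; exact mem_range_self _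
  have : y = f z - a - f z' := by rw [hzz]; abel
  rw [this]
  exact D.sub_mem (D.sub_mem h1 haD) h2

/-- An open set whose preimage lies in that of a closed set lies in the closed set itself, because
the range is dense; so preimages of nowhere dense sets are nowhere dense. -/
theorem IsDenseInducing.isMeagre_preimage {X Y : Type*} [TopologicalSpace X] [TopologicalSpace Y]
    {i : X → Y} (hi : IsDenseInducing i) {S : Set Y} (hS : IsMeagre S) : IsMeagre (i ⁻¹' S) := by
  rw [isMeagre_iff_countable_union_isNowhereDense] at hS
  obtain ⟨T, hT, hTc, hST⟩ := hS
  refine IsMeagre.mono (preimage_mono hST) ?_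
  rw [sUnion_eq_biUnion, preimage_iUnion₂]
  refine isMeagre_biUnion hTc fun K hK => IsNowhereDense.isMeagre ?_
  refine IsNowhereDense.mono (preimage_mono subset_closure) ?_
  rw [IsNowhereDense, (isClosed_closure.preimage hi.continuous).closure_eq, ← not_nonempty_iff_eq_empty]
  rintro ⟨x, hx⟩
  obtain ⟨V, hV, hVo, hxV⟩ := mem_interior.1 hx
  obtain ⟨V', hVo', rfl⟩ := hi.isOpen_iff.1 hVo
  have : V' ⊆ closure K := by
    intro y hy
    by_contra hyK
    obtain ⟨x', hx'⟩ := hi.dense.exists_mem_open (hVo'.sdiff isClosed_closure) ⟨y, hy, hyK⟩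
    exact hx'.2 (hV hx'.1)
  have h2 : i x ∈ interior (closure K) := mem_interior.2 ⟨V', this, hVo', hxV⟩
  rw [hT K hK] at h2
  exact h2

/-- A nonmeagre analytic metrizable group is Polish. -/
theorem polishSpace_of_not_isMeagre_univ {A : Type*} [AddCommGroup A] [TopologicalSpace A]
    [IsTopologicalAddGroup A] [TopologicalSpace.MetrizableSpace A] {f : (ℕ → ℕ) → A}
    (hf : Continuous f) (hfs : Function.Surjective f) (hm : ¬ IsMeagre (univ : Set A)) :
    PolishSpace A := by
  let := IsTopologicalAddGroup.rightUniformSpace A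
  have : IsUniformAddGroup A := isUniformAddGroup_of_addCommGroup
  have : (uniformity A).IsCountablyGenerated := IsUniformAddGroup.uniformity_countably_generated
  have : TopologicalSpace.SeparableSpace A := hfs.denseRange.separableSpace hf
  let := UniformSpace.pseudoMetricSpace A
  have : SecondCountableTopology (UniformSpace.Completion A) :=
    UniformSpace.secondCountable_of_separable _
  have hdi := UniformSpace.Completion.isDenseInducing_coe (α := A)
  let D : AddSubgroup (UniformSpace.Completion A) :=
    (UniformSpace.Completion.toCompl (α := A)).range
  have hDr : (D : Set (UniformSpace.Completion A)) = range ((↑) : A → UniformSpace.Completion A) :=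
    rfl
  have hD : (D : Set (UniformSpace.Completion A)) = univ := by
    refine D.eq_univ_of_not_isMeagre ?_ (f := fun x => (f x : UniformSpace.Completion A))
      (hdi.continuous.comp hf) ?_ ?_
    · rw [hDr]; exact hdi.dense
    · rw [hDr]; exact hfs.range_comp UniformSpace.Completion.coe'
    · intro h
      refine hm ?_
      have := hdi.isMeagre_preimage h
      rwa [hDr, preimage_range] at this
  rw [hDr, range_eq_univ] at hD
  have : CompleteSpace A := by
    have hi := UniformSpace.Completion.isUniformInducing_coe A
    rw [completeSpace_iff_isComplete_range hi, hD.range_eq]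
    exact completeSpace_iff_isComplete_univ.1 inferInstance
  have : SecondCountableTopology A := UniformSpace.secondCountable_of_separable _
  have : T0Space A := inferInstance
  infer_instance

/-! ### Piecewise linear approximation of curves -/

/-- The sum telescopes up to `k`, leaving a single interpolation between neighboring vertices. -/
theorem sum_clamp {E : Type*} [AddCommGroup E] [Module ℝ E] (e : ℕ → E) (w : ℕ → ℝ) {m k : ℕ}
    (hk : k < m) (h1 : ∀ j < k, w j = 1) (h0 : ∀ j, k < j → w j = 0) :
    e 0 + ∑ j ∈ Finset.range m, w j • (e (j + 1) - e j) = e k + w k • (e (k + 1) - e k) := by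
  have h2 : ∑ j ∈ Finset.range m, w j • (e (j + 1) - e j) =
      ∑ j ∈ Finset.range (k + 1), w j • (e (j + 1) - e j) := by
    symm
    refine Finset.sum_subset (Finset.range_mono hk) fun j _ hj => ?_
    rw [h0 j (by simpa using hj), zero_smul]
  have h3 : ∑ j ∈ Finset.range k, w j • (e (j + 1) - e j) = e k - e 0 := by
    rw [← Finset.sum_range_sub]
    exact Finset.sum_congr rfl fun j hj => by rw [h1 j (Finset.mem_range.1 hj), one_smul]
  rw [h2, Finset.sum_range_succ, h3]
  abel

/-- A curve in a topological vector space is a limit of piecewise linear curves with vertices on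
it. -/
theorem ContinuousMap.mem_closure_span_curve {E : Type*} [AddCommGroup E] [Module ℝ E]
    [TopologicalSpace E] [IsTopologicalAddGroup E] [ContinuousSMul ℝ E] (F : C(I, E)) :
    F ∈ closure (Submodule.span ℝ
      {G : C(I, E) | ∃ (w : C(I, ℝ)) (t : I), G = w • ContinuousMap.const I (F t)} :
        Set C(I, E)) := by
  rw [mem_closure_iff_nhds]
  intro 𝒱 h𝒱
  let := IsTopologicalAddGroup.rightUniformSpace E
  have : IsUniformAddGroup E := isUniformAddGroup_of_addCommGroup
  obtain ⟨V, hV, hV𝒱⟩ : ∃ V ∈ 𝓝 (0 : E), ∀ G : C(I, E), (∀ s, G s - F s ∈ V) → G ∈ 𝒱 := by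
    have h0 : (fun G : C(I, E) => F + G) ⁻¹' 𝒱 ∈ 𝓝 (ContinuousMap.const I (0 : E)) :=
      (continuous_const_add F).continuousAt.preimage_mem_nhds
        (by convert! h𝒱; exact add_zero F)
    obtain ⟨⟨K, V⟩, ⟨-, hV⟩, h⟩ :=
      ((𝓝 (0 : E)).basis_sets.nhds_continuousMapConst (X := I)).mem_iff.1 h0
    refine ⟨V, hV, fun G hG => ?_⟩
    have : F + (G - F) ∈ 𝒱 := @h (G - F) fun s _ => hG s
    rwa [add_sub_cancel] at this
  -- Only one interpolation term is active at a time, so balanced neighborhoods suffice and local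
  -- convexity is not needed.
  obtain ⟨B, ⟨hB, hBb⟩, hBV⟩ : ∃ B, (B ∈ 𝓝 (0 : E) ∧ Balanced ℝ B) ∧
      ∀ x ∈ B, ∀ y ∈ B, x + y ∈ V := by
    obtain ⟨B, hB, hBV⟩ := exists_nhds_zero_half hV
    obtain ⟨B', hB', hBB'⟩ := (nhds_basis_balanced ℝ E).mem_iff.1 hB
    exact ⟨B', hB', fun x hx y hy => hBV x (hBB' hx) y (hBB' hy)⟩
  obtain ⟨δ, hδ, hFδ⟩ : ∃ δ > 0, ∀ s t : I, dist s t < δ → F s - F t ∈ B := by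
    have hu := CompactSpace.uniformContinuous_of_continuous F.continuous
    have : ∀ᶠ p in uniformity I, F p.2 - F p.1 ∈ B := by
      have hB' : {q : E × E | q.2 - q.1 ∈ B} ∈ uniformity E := by
        rw [uniformity_eq_comap_nhds_zero]
        exact preimage_mem_comap hB
      exact hu hB'
    obtain ⟨δ, hδ, h⟩ := Metric.mem_uniformity_dist.1 this
    exact ⟨δ, hδ, fun s t hst => h (by rwa [dist_comm])⟩
  obtain ⟨m, hm⟩ := exists_nat_gt (2 / δ)
  have hm0 : (0 : ℝ) < m := lt_trans (by positivity) hm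
  let p (j : ℕ) : I := projIcc 0 1 zero_le_one (j / m : ℝ)
  -- A ramp rising from 0 to 1 between the nodes `j / m` and `(j + 1) / m`.
  let w (j : ℕ) : C(I, ℝ) := ⟨fun s => (projIcc (0 : ℝ) 1 zero_le_one (m * (s : ℝ) - j) : ℝ),
    by fun_prop⟩
  refine ⟨ContinuousMap.const I (F (p 0)) + ∑ j ∈ Finset.range m,
    (w j • ContinuousMap.const I (F (p (j + 1))) - w j • ContinuousMap.const I (F (p j))),
    hV𝒱 _ ?_, ?_⟩
  · intro s
    obtain ⟨k, hkm, hk1, hk2⟩ : ∃ k < m, (k : ℝ) ≤ m * s ∧ (m * s : ℝ) ≤ k + 1 := by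
      have hs0 : (0 : ℝ) ≤ m * s := mul_nonneg hm0.le s.2.1
      have hm' : 0 < m := by exact_mod_cast hm0
      rcases lt_or_ge ⌊(m * s : ℝ)⌋₊ m with h | h
      · exact ⟨_, h, Nat.floor_le hs0, (Nat.lt_floor_add_one _).le⟩
      · have h1 : (m : ℝ) ≤ m * s := (Nat.le_floor_iff hs0).1 h
        have h2 : (m * s : ℝ) ≤ m := mul_le_of_le_one_right hm0.le s.2.2
        exact ⟨m - 1, by omega, by push_cast [Nat.cast_sub hm']; linarith,
          by push_cast [Nat.cast_sub hm']; linarith⟩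
    have hp (j : ℕ) (hj : j ≤ m) : (p j : ℝ) = j / m := by
      have : (j / m : ℝ) ∈ Icc (0 : ℝ) 1 := ⟨by positivity, by
        rw [div_le_one hm0]; exact_mod_cast hj⟩
      exact congrArg Subtype.val (projIcc_of_mem zero_le_one this)
    have hδm : 1 / (m : ℝ) < δ := by
      rw [div_lt_iff₀ hm0]
      rw [div_lt_iff₀ hδ] at hm
      linarith
    have hd1 : dist (p k) s < δ := by
      rw [Subtype.dist_eq, Real.dist_eq, hp k hkm.le, abs_sub_comm]
      refine lt_of_le_of_lt ?_ hδm
      have : (s - k / m : ℝ) = (m * s - k) / m := by field_simp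
      rw [this, abs_div, abs_of_pos hm0, abs_of_nonneg (by linarith)]
      gcongr
      linarith
    have hd2 : dist (p (k + 1)) (p k) < δ := by
      rw [Subtype.dist_eq, Real.dist_eq, hp k hkm.le, hp (k + 1) hkm]
      have : ((k + 1 : ℕ) / m - k / m : ℝ) = 1 / m := by push_cast; ring
      rw [this, abs_of_pos (by positivity)]
      exact hδm
    have hsum := sum_clamp (fun j => F (p j)) (fun j => w j s) hkm
      (fun j hj => by
        have : (1 : ℝ) ≤ m * s - j := by
          have : (j + 1 : ℝ) ≤ k := by exact_mod_cast hj
          linarith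
        exact congrArg Subtype.val (projIcc_of_right_le zero_le_one this))
      (fun j hj => by
        have : (m * s - j : ℝ) ≤ 0 := by
          have : (k + 1 : ℝ) ≤ j := by exact_mod_cast hj
          linarith
        exact congrArg Subtype.val (projIcc_of_le_left zero_le_one this))
    have heval : (ContinuousMap.const I (F (p 0)) + ∑ j ∈ Finset.range m,
        (w j • ContinuousMap.const I (F (p (j + 1))) - w j • ContinuousMap.const I (F (p j)))) s =
        F (p 0) + ∑ j ∈ Finset.range m, w j s • (F (p (j + 1)) - F (p j)) := by
      simp [ContinuousMap.sum_apply, smul_sub]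
    rw [heval, hsum, add_sub_right_comm]
    have hw : ‖w k s‖ ≤ 1 := by
      have := (projIcc (0 : ℝ) 1 zero_le_one (m * (s : ℝ) - k)).2
      rw [Real.norm_eq_abs, abs_le]
      exact ⟨neg_one_lt_zero.le.trans this.1, this.2⟩
    exact hBV _ (hFδ _ _ hd1) _ (hBb.smul_mem hw (hFδ _ _ hd2))
  · refine Submodule.add_mem _ ?_ (Submodule.sum_mem _ fun j _ => Submodule.sub_mem _ ?_ ?_)
    · exact Submodule.subset_span ⟨1, p 0, by simp⟩
    · exact Submodule.subset_span ⟨_, _, rfl⟩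
    · exact Submodule.subset_span ⟨_, _, rfl⟩

/-! ### Finite-dimensional approximation of maps from the Hilbert cube -/

section Approximation

variable {X : Type*} [AddCommGroup X] [Module ℝ X] [TopologicalSpace X]
  [IsTopologicalAddGroup X] [ContinuousSMul ℝ X]

/-- Finite sums of maps `w • d` with `w` a scalar function and `d ∈ D`. -/
def finiteSpanMaps (Q : Type*) [TopologicalSpace Q] (D : Set X) : Submodule ℝ C(Q, X) :=
  Submodule.span ℝ {G | ∃ (w : C(Q, ℝ)), ∃ d ∈ D, G = w • ContinuousMap.const Q d}

variable {Q : Type*} [TopologicalSpace Q] [LocallyCompactSpace Q] {D : Set X}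

theorem smul_const_mem_closure_finiteSpanMaps (hD : Dense (Submodule.span ℝ D : Set X))
    (w : C(Q, ℝ)) (x : X) :
    w • ContinuousMap.const Q x ∈ (finiteSpanMaps Q D).topologicalClosure := by
  let T : X →ₗ[ℝ] C(Q, X) :=
    { toFun := fun x => w • ContinuousMap.const Q x
      map_add' := fun x y => by ext; simp
      map_smul' := fun r x => by ext q; exact smul_comm _ _ _ }
  have hT : Continuous T :=
    ContinuousMap.continuous_of_continuous_uncurry _
      (by change Continuous fun p : X × Q => w p.2 • p.1; fun_prop)
  have h : MapsTo T (Submodule.span ℝ D) (finiteSpanMaps Q D) := by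
    intro y hy
    have : Submodule.span ℝ D ≤ (finiteSpanMaps Q D).comap T :=
      Submodule.span_le.2 fun d hd => Submodule.subset_span ⟨w, d, hd, rfl⟩
    exact this hy
  exact h.closure hT (hD x)

theorem smul_mem_closure_finiteSpanMaps (w : C(Q, ℝ)) {f : C(Q, X)}
    (hf : f ∈ (finiteSpanMaps Q D).topologicalClosure) :
    w • f ∈ (finiteSpanMaps Q D).topologicalClosure := by
  let T : C(Q, X) →ₗ[ℝ] C(Q, X) :=
    { toFun := fun x => w • x
      map_add' := fun x y => by ext; simp
      map_smul' := fun r x => by ext q; exact smul_comm _ _ _ }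
  have hT : Continuous T :=
    ContinuousMap.continuous_of_continuous_uncurry _
      (by change Continuous fun p : C(Q, X) × Q => w p.2 • p.1 p.2; fun_prop)
  have h : MapsTo T (finiteSpanMaps Q D) (finiteSpanMaps Q D) := by
    intro y hy
    have : finiteSpanMaps Q D ≤ (finiteSpanMaps Q D).comap T := by
      refine Submodule.span_le.2 ?_
      rintro _ ⟨v, d, hd, rfl⟩
      exact Submodule.subset_span ⟨w * v, d, hd, by ext q; simp [T, mul_smul]⟩
    exact this hy
  exact h.closure hT hf

/-- Freezing coordinate `n` at `t` turns `f` into a curve in the vector space `C(ℕ → I, X)`. The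
curve lemma approximates it by sums of `w(q n) • F t`, and each `F t` depends on one coordinate
fewer. -/
theorem mem_closure_finiteSpanMaps_of_finite_dependence
    (hD : Dense (Submodule.span ℝ D : Set X)) (n : ℕ) (f : C(ℕ → I, X))
    (hf : ∀ q q' : ℕ → I, (∀ i < n, q i = q' i) → f q = f q') :
    f ∈ (finiteSpanMaps (ℕ → I) D).topologicalClosure := by
  induction n generalizing f with
  | zero =>
    have : f = (1 : C(ℕ → I, ℝ)) • ContinuousMap.const _ (f 0) := by
      ext q
      simp [hf q 0 (by simp)]
    rw [this]
    exact smul_const_mem_closure_finiteSpanMaps hD _ _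
  | succ n ih =>
    let F : C(I, C(ℕ → I, X)) := ContinuousMap.curry
      ⟨fun p : I × (ℕ → I) => f (Function.update p.2 n p.1),
        f.continuous.comp (continuous_snd.update n continuous_fst)⟩
    let T : C(I, C(ℕ → I, X)) →ₗ[ℝ] C(ℕ → I, X) :=
      { toFun := fun Φ => ⟨fun q => Φ (q n) q, by fun_prop⟩
        map_add' := fun x y => by ext; simp
        map_smul' := fun r x => by ext q; simp }
    have hT : Continuous T :=
      ContinuousMap.continuous_of_continuous_uncurry _
        (by change Continuous fun p : C(I, C(ℕ → I, X)) × (ℕ → I) => p.1 (p.2 n) p.2; fun_prop)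
    have hTF : T F = f := by
      ext q
      change f (Function.update q n (q n)) = f q
      rw [Function.update_eq_self]
    rw [← hTF]
    have h : MapsTo T (Submodule.span ℝ
        {G : C(I, C(ℕ → I, X)) | ∃ (w : C(I, ℝ)) (t : I), G = w • ContinuousMap.const I (F t)})
        (finiteSpanMaps (ℕ → I) D).topologicalClosure := by
      intro y hy
      refine (Submodule.span_le (p := (finiteSpanMaps (ℕ → I) D).topologicalClosure.comap T)).2
        ?_ hy
      rintro _ ⟨w, t, rfl⟩
      have hw : T (w • ContinuousMap.const I (F t)) =
          (w.comp ⟨fun q : ℕ → I => q n, continuous_apply n⟩) • F t := by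
        ext q
        simp [T]
      rw [SetLike.mem_coe, Submodule.mem_comap, hw]
      refine smul_mem_closure_finiteSpanMaps _ (ih _ fun q q' hqq => hf _ _ fun i hi => ?_)
      rcases eq_or_ne i n with rfl | hne
      · simp
      · simp [hne, hqq i (by omega)]
    have := h.closure hT (ContinuousMap.mem_closure_span_curve F)
    rwa [(Submodule.isClosed_topologicalClosure _).closure_eq] at this

/-- Maps from the Hilbert cube to a topological vector space are approximated by finite sums
`∑ wᵢ • dᵢ`, with the `dᵢ` in a given set with dense linear span. -/
theorem dense_finiteSpanMaps (hD : Dense (Submodule.span ℝ D : Set X)) :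
    Dense (finiteSpanMaps (ℕ → I) D : Set C(ℕ → I, X)) := by
  intro f
  let Φ : C(ℕ → I, C(ℕ → I, X)) := ContinuousMap.curry
    ⟨fun p : (ℕ → I) × (ℕ → I) => f (p.1 * p.2), by fun_prop⟩
  -- Multiplication by `a n` sets the coordinates from `n` on to zero.
  let a (n : ℕ) : ℕ → I := fun i => if i < n then 1 else 0
  have ha : Tendsto a atTop (𝓝 1) := by
    rw [tendsto_pi_nhds]
    intro i
    refine tendsto_const_nhds.congr' ?_
    filter_upwards [eventually_gt_atTop i] with n hn
    simp [a, hn]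
  have h1 : Φ 1 = f := by
    ext q
    simp [Φ]
  rw [← h1]
  refine (Submodule.isClosed_topologicalClosure (finiteSpanMaps (ℕ → I) D)).mem_of_tendsto
    ((Φ.continuous.tendsto 1).comp ha) (Eventually.of_forall fun n => ?_)
  refine mem_closure_finiteSpanMaps_of_finite_dependence hD n _ fun q q' hqq => ?_
  change f (a n * q) = f (a n * q')
  congr 1
  ext i
  by_cases hi : i < n
  · simp [a, hi, hqq i hi]
  · simp [a, hi]

/-- A finite sum of maps `w • d` in explicit form. -/
theorem exists_sum_of_mem_finiteSpanMaps {Q : Type*} [TopologicalSpace Q] {f : C(Q, X)}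
    (hf : f ∈ finiteSpanMaps Q D) :
    ∃ (n : ℕ) (w : Fin n → C(Q, ℝ)) (d : Fin n → X), (∀ i, d i ∈ D) ∧
      ∀ q, f q = ∑ i, w i q • d i := by
  obtain ⟨n, r, g, rfl⟩ := Submodule.mem_span_set'.1 hf
  choose w d hd hg using fun i => (g i).2
  refine ⟨n, fun i => r i • w i, d, hd, fun q => ?_⟩
  simp [ContinuousMap.sum_apply, hg, smul_smul]

end Approximation

/-! ### Convex sets in additive subgroups -/

theorem Convex.add_sum_smul_sub_mem {X : Type*} [AddCommGroup X] [Module ℝ X] {C : Set X}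
    (hC : Convex ℝ C) {c : X} (hc : c ∈ C) {ι : Type*} [Fintype ι] {x : ι → X}
    (hx : ∀ i, x i ∈ C) {t : ι → ℝ} (ht : ∀ i, 0 ≤ t i) (ht1 : ∑ i, t i ≤ 1) :
    c + ∑ i, t i • (x i - c) ∈ C := by
  have := hC.sum_mem (t := Finset.univ) (w := fun o : Option ι => o.elim (1 - ∑ i, t i) t)
    (z := fun o => o.elim c x) (by rintro (_ | i) - <;> simp [ht, ht1]) (by simp)
    (by rintro (_ | i) - <;> simp [hc, hx])
  rw [Fintype.sum_option] at this
  convert! this using 1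
  simp only [Option.elim, smul_sub, Finset.sum_sub_distrib, sub_smul, one_smul, Finset.sum_smul]
  abel

/-- Split a real multiple of `y - c` into integer and fractional parts: the first stays in the
group, the second is a difference of two points of `C`. -/
theorem Convex.span_sub_subset_addSubgroup {X : Type*} [AddCommGroup X] [Module ℝ X]
    (A : AddSubgroup X) {C : Set X} (hC : Convex ℝ C) (hCA : C ⊆ A) {c : X} (hc : c ∈ C) {x : X}
    (hx : x ∈ Submodule.span ℝ ((fun y => y - c) '' C)) : x ∈ A := by
  let L : Submodule ℝ X :=
    { carrier := {x | ∀ r : ℝ, r • x ∈ A}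
      add_mem' := fun {x y} hx hy r => by rw [smul_add]; exact A.add_mem (hx r) (hy r)
      zero_mem' := fun r => by rw [smul_zero]; exact A.zero_mem
      smul_mem' := fun s x hx r => by rw [smul_smul]; exact hx _ }
  have hL : Submodule.span ℝ ((fun y => y - c) '' C) ≤ L := by
    rw [Submodule.span_le]
    rintro _ ⟨y, hy, rfl⟩ r
    have h01 (t : ℝ) (h0 : 0 ≤ t) (h1 : t ≤ 1) : t • (y - c) ∈ A := by
      have := A.sub_mem (hCA (hC.add_smul_sub_mem hc hy ⟨h0, h1⟩)) (hCA hc)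
      rwa [add_sub_cancel_left] at this
    have h2 : r • (y - c) = Int.fract r • (y - c) + ⌊r⌋ • ((1 : ℝ) • (y - c)) := by
      rw [one_smul, ← Int.cast_smul_eq_zsmul ℝ, ← add_smul, Int.fract_add_floor]
    rw [h2]
    exact A.add_mem (h01 _ (Int.fract_nonneg r) (Int.fract_lt_one r).le)
      (A.zsmul_mem (h01 1 zero_le_one le_rfl) _)
  have := hL hx 1
  rwa [one_smul] at this

theorem interior_biUnion_finset_eq_empty {Y ι : Type*} [TopologicalSpace Y] (s : Finset ι)
    {M : ι → Set Y} (hM : ∀ i ∈ s, IsClosed (M i)) (hM' : ∀ i ∈ s, interior (M i) = ∅) :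
    interior (⋃ i ∈ s, M i) = ∅ := by
  classical
  induction s using Finset.induction_on with
  | empty => simp
  | insert i s _ ih =>
    rw [Finset.set_biUnion_insert, interior_union_isClosed_of_interior_empty
      (hM i (Finset.mem_insert_self i s))
      (ih (fun j hj => hM j (Finset.mem_insert_of_mem hj))
        fun j hj => hM' j (Finset.mem_insert_of_mem hj))]
    exact hM' i (Finset.mem_insert_self i s)

/-! ### A criterion for `Z_ω`-sets in a subgroup -/

section ZOmega

variable {X : Type*} [AddCommGroup X] [Module ℝ X] [TopologicalSpace X]
  [IsTopologicalAddGroup X] [ContinuousSMul ℝ X]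

/-- The image of a finite-dimensional map is covered by finitely many translates of a given
neighborhood of a point in a convex set. -/
theorem exists_finset_translates {Q : Type*} [TopologicalSpace Q] [CompactSpace Q] {C : Set X}
    (hC : Convex ℝ C) {c : X} (hc : c ∈ C) {N : Set X} (hN : N ∈ 𝓝 c) {f : C(Q, X)}
    (hf : f ∈ finiteSpanMaps Q ((fun y => y - c) '' C)) :
    ∃ s : Finset X, (∀ b ∈ s, b ∈ Submodule.span ℝ ((fun y => y - c) '' C)) ∧
      ∀ q, ∃ b ∈ s, ∃ x ∈ N ∩ C, f q = b + (x - c) := by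
  classical
  obtain ⟨n, w, d, hd, hfw⟩ := exists_sum_of_mem_finiteSpanMaps hf
  choose y hyC hyd using hd
  obtain ⟨r, hr, hrN⟩ : ∃ r > 0, ∀ t : Fin n → ℝ, (∀ i, |t i| < r) →
      c + ∑ i, t i • (y i - c) ∈ N := by
    have hcont : Continuous fun t : Fin n → ℝ => c + ∑ i, t i • (y i - c) := by fun_prop
    have hpre : (fun t : Fin n → ℝ => c + ∑ i, t i • (y i - c)) ⁻¹' N ∈ 𝓝 0 :=
      hcont.continuousAt.preimage_mem_nhds (by simpa using hN)
    obtain ⟨r, hr, h⟩ := Metric.mem_nhds_iff.1 hpre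
    refine ⟨r, hr, fun t ht => h ?_⟩
    rw [mem_ball_zero_iff, pi_norm_lt_iff hr]
    exact ht
  -- The bound `r` keeps the remainders inside `N`; the bound `1 / (n + 1)` keeps their sum at most
  -- 1, hence the point inside `C`.
  let δ : ℝ := min r (1 / (n + 1))
  have hδ : 0 < δ := lt_min hr (by positivity)
  have hbdd (i : Fin n) : ∃ R : ℝ, ∀ q, |w i q / δ| ≤ R := by
    obtain ⟨R, hR⟩ := (isCompact_range
      (((w i).continuous.div_const δ).abs)).bddAbove
    exact ⟨R, fun q => hR ⟨q, rfl⟩⟩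
  choose R hR using hbdd
  -- Coefficients are rounded down to multiples of `δ`; by compactness of `Q` only finitely many
  -- grid points occur.
  refine ⟨(Finset.Icc (fun i => ⌊-R i⌋) (fun i => ⌊R i⌋)).image
    (fun k : Fin n → ℤ => ∑ i, (δ * k i) • (y i - c)), ?_, fun q => ?_⟩
  · intro b hb
    obtain ⟨k, -, rfl⟩ := Finset.mem_image.1 hb
    exact Submodule.sum_mem _ fun i _ => Submodule.smul_mem _ _
      (Submodule.subset_span ⟨y i, hyC i, rfl⟩)
  · let t (i : Fin n) : ℝ := δ * Int.fract (w i q / δ)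
    have ht0 (i) : 0 ≤ t i := mul_nonneg hδ.le (Int.fract_nonneg _)
    have htδ (i) : t i < δ := mul_lt_of_lt_one_right hδ (Int.fract_lt_one _)
    refine ⟨_, Finset.mem_image.2 ⟨fun i => ⌊w i q / δ⌋, Finset.mem_Icc.2
      ⟨fun i => Int.floor_mono (abs_le.1 (hR i q)).1,
        fun i => Int.floor_mono (abs_le.1 (hR i q)).2⟩, rfl⟩,
      c + ∑ i, t i • (y i - c), ⟨hrN t fun i => ?_, hC.add_sum_smul_sub_mem hc hyC ht0 ?_⟩, ?_⟩
    · rw [abs_of_nonneg (ht0 i)]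
      exact (htδ i).trans_le (min_le_left _ _)
    · calc ∑ i, t i ≤ ∑ _i : Fin n, (1 / (n + 1) : ℝ) :=
            Finset.sum_le_sum fun i _ => (htδ i).le.trans (min_le_right _ _)
        _ = n / (n + 1) := by simp [div_eq_mul_inv]
        _ ≤ 1 := by rw [div_le_one (by positivity)]; linarith
    · rw [add_sub_cancel_left, ← Finset.sum_add_distrib, hfw]
      refine Finset.sum_congr rfl fun i _ => ?_
      rw [← hyd i, ← add_smul, ← mul_add, Int.floor_add_fract, mul_div_cancel₀ _ hδ.ne']

/-- General position by translation: after approximation by a finite-dimensional `g`, all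
differences between `closure S` and the image of `g` lie in a finite union `M` of translates of `K`.
Any `a ∉ M` makes `g + a` avoid `closure S`, and `a` can be taken near zero since `M` has empty
interior. -/
theorem isZOmegaSet_closure (A : AddSubgroup X) {C : Set X} (hCA : C ⊆ A) (hC : Convex ℝ C)
    {c : X} (hc : c ∈ C) (hD : Dense (Submodule.span ℝ ((fun y => y - c) '' C) : Set X))
    {N : Set X} (hN : N ∈ 𝓝 c) {S K : Set A} (hK : IsClosed K) (hK' : interior K = ∅)
    (h : ∀ s ∈ S, ∀ x : A, (x : X) ∈ N ∩ C → s - x ∈ K) : IsZOmegaSet (closure S) := by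
  refine ⟨isClosed_closure, ?_⟩
  rw [IsOmegaDense, dense_iff_inter_open]
  rintro O hO ⟨f, hfO⟩
  let i : C(A, X) := ⟨Subtype.val, continuous_subtype_val⟩
  obtain ⟨O', hO', rfl⟩ := (i.isInducing_postcomp IsInducing.subtypeVal).isOpen_iff.1 hO
  obtain ⟨f', hf'O, hf'⟩ := (dense_finiteSpanMaps hD).inter_open_nonempty O' hO' ⟨_, hfO⟩
  obtain ⟨s, hs, hsf⟩ := exists_finset_translates hC hc hN hf'
  have hspan {x : X} (hx : x ∈ Submodule.span ℝ ((fun y => y - c) '' C)) : x ∈ A :=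
    hC.span_sub_subset_addSubgroup A hCA hc hx
  have hf'A (q) : f' q ∈ A := by
    obtain ⟨b, hb, x, hx, hq⟩ := hsf q
    rw [hq]
    exact A.add_mem (hspan (hs b hb)) (A.sub_mem (hCA hx.2) (hCA hc))
  let g : C(ℕ → I, A) := ⟨fun q => ⟨f' q, hf'A q⟩, f'.continuous.subtype_mk _⟩
  have hg : g ∈ i.comp ⁻¹' O' := hf'O
  let e (b : s) : A ≃ₜ A :=
    Homeomorph.addRight (⟨b, hspan (hs b b.2)⟩ - ⟨c, hCA hc⟩)
  let M : Set A := ⋃ b ∈ (Finset.univ : Finset s), e b ⁻¹' K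
  have hMc : IsClosed M :=
    isClosed_biUnion_finset fun b _ => hK.preimage (e b).continuous
  have hM : interior M = ∅ := by
    refine interior_biUnion_finset_eq_empty _ (fun b _ => hK.preimage (e b).continuous)
      fun b _ => ?_
    rw [← (e b).preimage_interior, hK', preimage_empty]
  have hSM (q) : closure S ⊆ (fun a : A => a - g q) ⁻¹' M := by
    refine closure_minimal (fun a ha => ?_) (hMc.preimage (by fun_prop))
    obtain ⟨b, hb, x, hx, hq⟩ := hsf q
    refine mem_biUnion (Finset.mem_coe.2 (Finset.mem_univ (⟨b, hb⟩ : s))) ?_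
    have hax := h a ha ⟨x, hCA hx.2⟩ hx
    have : a - ⟨x, hCA hx.2⟩ = e ⟨b, hb⟩ (a - g q) := by
      apply Subtype.ext
      change (a : X) - x = a - f' q + (b - c)
      rw [hq]
      abel
    rwa [this] at hax
  have hcont : Continuous fun a : A => g + ContinuousMap.const (ℕ → I) a :=
    continuous_const.add ContinuousMap.continuous_const'
  have hopen := hO.preimage hcont
  have hzero : (0 : A) ∈ (fun a : A => g + ContinuousMap.const (ℕ → I) a) ⁻¹' (i.comp ⁻¹' O') := by
    have : g + ContinuousMap.const (ℕ → I) (0 : A) = g := by ext; simp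
    rw [mem_preimage, this]
    exact hg
  obtain ⟨a, haO, haM⟩ : ∃ a ∈ (fun a : A => g + ContinuousMap.const (ℕ → I) a) ⁻¹'
      (i.comp ⁻¹' O'), a ∉ M := by
    by_contra! hcon
    have : (0 : A) ∈ interior M := mem_interior.2 ⟨_, hcon, hopen, hzero⟩
    rw [hM] at this
    exact this
  refine ⟨_, haO, fun q hq => haM ?_⟩
  have := hSM q hq
  simpa using this

/-- `B` is covered by countably many `Z_ω`-sets. -/
def IsSigmaZOmegaCovered {Y : Type*} [TopologicalSpace Y] (B : Set Y) : Prop :=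
  ∃ 𝒮 : Set (Set Y), 𝒮.Countable ∧ (∀ F ∈ 𝒮, IsZOmegaSet F) ∧ B ⊆ ⋃₀ 𝒮

theorem IsSigmaZOmegaCovered.isSigmaZOmegaSpace {Y : Type*} [TopologicalSpace Y]
    (h : IsSigmaZOmegaCovered (univ : Set Y)) : IsSigmaZOmegaSpace Y := by
  obtain ⟨𝒮, hc, hZ, hcov⟩ := h
  have hempty : IsZOmegaSet (∅ : Set Y) := ⟨isClosed_empty, by simp [IsOmegaDense]⟩
  obtain ⟨F, hF⟩ := (hc.insert ∅).exists_eq_range (insert_nonempty _ _)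
  refine ⟨F, fun n => ?_, eq_univ_of_univ_subset (hcov.trans ?_)⟩
  · rcases (hF.symm ▸ mem_range_self n : F n ∈ insert ∅ 𝒮) with h | h
    · rw [h]; exact hempty
    · exact hZ _ h
  · rw [← sUnion_range, ← hF]
    exact sUnion_subset_sUnion (subset_insert _ _)

theorem IsSigmaZOmegaCovered.biUnion {Y ι : Type*} [TopologicalSpace Y] {T : Set ι}
    (hT : T.Countable) {B : ι → Set Y} (h : ∀ i ∈ T, IsSigmaZOmegaCovered (B i)) :
    IsSigmaZOmegaCovered (⋃ i ∈ T, B i) := by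
  choose! 𝒮 hc hZ hcov using h
  refine ⟨⋃ i ∈ T, 𝒮 i, hT.biUnion hc, fun F hF => ?_, iUnion₂_subset fun i hi x hx => ?_⟩
  · obtain ⟨i, hi, hF⟩ := mem_iUnion₂.1 hF
    exact hZ i hi F hF
  · obtain ⟨F, hF, hxF⟩ := hcov i hi hx
    exact ⟨F, mem_biUnion hi hF, hxF⟩

theorem IsSigmaZOmegaCovered.union_of_subset {Y : Type*} [TopologicalSpace Y] {B B' F : Set Y}
    (h : IsSigmaZOmegaCovered B) (hF : IsZOmegaSet F) (hB : B' ⊆ B ∪ F) :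
    IsSigmaZOmegaCovered B' := by
  obtain ⟨𝒮, hc, hZ, hcov⟩ := h
  refine ⟨insert F 𝒮, hc.insert F, forall_mem_insert.2 ⟨hF, hZ⟩, hB.trans ?_⟩
  rw [sUnion_insert, union_comm]
  exact union_subset_union_right _ hcov

end ZOmega

/-! ### The Baire category argument -/

theorem mainTheorem2 {X : Type*} [AddCommGroup X] [Module ℝ X] [TopologicalSpace X]
    [IsTopologicalAddGroup X] [ContinuousSMul ℝ X] [TopologicalSpace.MetrizableSpace X]
    (A : AddSubgroup X) (hA : MeasureTheory.AnalyticSet (A : Set X)) (hA' : ¬ PolishSpace A)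
    (hC : ∃ C : Set X, C ⊆ (A : Set X) ∧ Convex ℝ C ∧ DenselyPolishSpace C ∧
      Dense (affineSpan ℝ C : Set X)) :
    IsSigmaZOmegaSpace A := by
  obtain ⟨C, hCA, hC, ⟨P, hP, hPP⟩, hCd⟩ := hC
  have hCn : C.Nonempty := (affineSpan_nonempty ℝ).1 hCd.nonempty
  have hPn : P.Nonempty := by
    have := hCn.to_subtype
    exact hP.nonempty
  have hD (c : X) (hc : c ∈ C) : Dense (Submodule.span ℝ ((fun y => y - c) '' C) : Set X) := by
    have h1 : (Submodule.span ℝ ((fun y => y - c) '' C) : Set X) =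
        (fun y => y - c) '' (affineSpan ℝ C : Set X) := by
      have h2 := (affineSpan ℝ C).coe_direction_eq_vsub_set_right (subset_affineSpan ℝ C hc)
      rw [direction_affineSpan, vectorSpan_eq_span_vsub_set_right ℝ hc] at h2
      exact h2
    rw [h1]
    exact (Homeomorph.subRight c).surjective.denseRange.dense_image
      (Homeomorph.subRight c).continuous hCd
  obtain ⟨f, hf, hfs⟩ : ∃ f : (ℕ → ℕ) → A, Continuous f ∧ Function.Surjective f := by
    rw [MeasureTheory.AnalyticSet] at hA
    obtain h | ⟨f, hf, hfA⟩ := hA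
    · exact absurd h (Set.Nonempty.ne_empty ⟨0, A.zero_mem⟩)
    · have hmem (z) : f z ∈ A := by rw [← SetLike.mem_coe, ← hfA]; exact mem_range_self z
      refine ⟨fun z => ⟨f z, hmem z⟩, hf.subtype_mk _, fun a => ?_⟩
      obtain ⟨z, hz⟩ : (a : X) ∈ range f := hfA ▸ a.2
      exact ⟨z, Subtype.ext hz⟩
  have hmeagre : IsMeagre (univ : Set A) := by
    have : TopologicalSpace.MetrizableSpace A := IsEmbedding.subtypeVal.metrizableSpace
    by_contra hm
    exact hA' (polishSpace_of_not_isMeagre_univ hf hfs hm)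
  obtain ⟨𝒦, h𝒦, h𝒦c, hcov⟩ := isMeagre_iff_countable_union_isNowhereDense.1 hmeagre
  let 𝒪 : Set (Set (ℕ → ℕ)) := {O | IsOpen O ∧ IsSigmaZOmegaCovered (f '' O)}
  have hWo : IsOpen (⋃₀ 𝒪) := isOpen_sUnion fun O hO => hO.1
  have hW : IsSigmaZOmegaCovered (f '' ⋃₀ 𝒪) := by
    obtain ⟨T, hTc, hT𝒪, hTU⟩ :=
      TopologicalSpace.isOpen_sUnion_countable 𝒪 fun O hO => hO.1
    rw [← hTU, sUnion_eq_biUnion, image_iUnion₂]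
    exact IsSigmaZOmegaCovered.biUnion hTc fun O hO => (hT𝒪 hO).2
  suffices hWu : ⋃₀ 𝒪 = univ by
    rw [hWu, image_univ, hfs.range_eq] at hW
    exact hW.isSigmaZOmegaSpace
  by_contra hWu
  -- By the Lindelöf property the discarded part is itself covered, so `G` is what remains to be
  -- excluded; being closed, it is Polish.
  let G : Set (ℕ → ℕ) := (⋃₀ 𝒪)ᶜ
  have hGn : Nonempty G := (nonempty_compl.2 hWu).to_subtype
  have := hPn.to_subtype
  have : PolishSpace G := hWo.isClosed_compl.polishSpace
  let φ : C → A := fun x => ⟨x, hCA x.2⟩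
  have hφ : Continuous φ := continuous_subtype_val.subtype_mk _
  let Ψ : G × P → A := fun p => f p.1 - φ p.2
  have hΨ : Continuous Ψ := by fun_prop
  have := h𝒦c.to_subtype
  obtain ⟨⟨K, hK⟩, ⟨z, p⟩, hzp⟩ := nonempty_interior_of_iUnion_of_closed
    (f := fun K : 𝒦 => Ψ ⁻¹' closure K.1) (fun K => isClosed_closure.preimage hΨ) (by
      refine eq_univ_of_forall fun p => ?_
      obtain ⟨K, hK, hpK⟩ := hcov (mem_univ (Ψ p))
      exact mem_iUnion.2 ⟨⟨K, hK⟩, subset_closure hpK⟩)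
  obtain ⟨U, hU, V, hV, hUV⟩ := mem_nhds_prod_iff.1 (mem_interior_iff_mem_nhds.1 hzp)
  obtain ⟨U', hU', hUU'⟩ := mem_nhds_subtype G z U |>.1 hU
  obtain ⟨O, hOU, hO, hzO⟩ := mem_nhds_iff.1 hU'
  obtain ⟨V', hV', hVV'⟩ := mem_nhds_subtype P p V |>.1 hV
  obtain ⟨V₀, hVV₀, hV₀, hpV⟩ := mem_nhds_iff.1 hV'
  obtain ⟨N, hN, rfl⟩ := isOpen_induced_iff.1 hV₀
  have hZ : IsZOmegaSet (closure (f '' (O ∩ G))) := by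
    refine isZOmegaSet_closure A hCA hC p.1.2 (hD _ p.1.2) (hN.mem_nhds hpV)
      isClosed_closure (h𝒦 K hK) ?_
    rintro _ ⟨y, ⟨hyO, hyG⟩, rfl⟩ x ⟨hxN, hxC⟩
    -- Baire controls the differences only for points of `P`; density of `P` in `C` and closedness
    -- of `closure K` extend this to `N ∩ C`.
    have hcl : closure (Subtype.val ⁻¹' N ∩ P) ⊆ (fun c : C => f y - φ c) ⁻¹' closure K := by
      refine closure_minimal ?_ (isClosed_closure.preimage (by fun_prop))
      rintro c ⟨hcN, hcP⟩
      exact @hUV (⟨y, hyG⟩, ⟨c, hcP⟩) ⟨hUU' (hOU hyO), hVV' (hVV₀ hcN)⟩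
    exact hcl (hP.open_subset_closure_inter hV₀ (show (⟨x, hxC⟩ : C) ∈ _ from hxN))
  -- The image of `O` is covered by that of the discarded part and one more `Z_ω`-set, so `O` should
  -- have been discarded, although it contains `z ∈ G`.
  refine z.2 ⟨O, ⟨hO, hW.union_of_subset hZ ?_⟩, hzO⟩
  rintro _ ⟨y, hyO, rfl⟩
  by_cases hy : y ∈ ⋃₀ 𝒪
  · exact Or.inl ⟨y, hy, rfl⟩
  · exact Or.inr (subset_closure ⟨y, ⟨hyO, hy⟩, rfl⟩)
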